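/- Let $0<a\le b<2$ and let $\alpha:\mathbb R\to\mathbb R$ be a Lebesgue measurable function with $\alpha(x)\in[a,b]$ for almost every $x\in\mathbb R$. Let $\mathcal F_\alpha$ be the space of Lebesgue measurable functions $f:\mathbb R\to\mathbb R$ with $\int_{\mathbb R}|f(x)|^{\alpha(x)}\,dx<\infty$, with the quasinorm $\|\cdot\|_\alpha$ for which $\|f\|_\alpha=0$ if $f=0$ almost everywhere, and otherwise $\|f\|_\alpha$ is the unique $r\in(0,\infty)$ with $\int_{\mathbb R}|r^{-1}f(x)|^{\alpha(x)}\,dx=1$. Let $\mathcal S_\alpha=\{f\in\mathcal F_\alpha:\|f\|_\alpha=1\}$. Let $\{I(f):f\in\mathcal F_\alpha\}$ be the multistable stochastic integral, that is, a real-valued stochastic process on a probability space such that for all integers $d\ge1$, all $f_1,\dots,f_d\in\mathcal F_\alpha$ and all $\theta_1,\dots,\theta_d\in\mathbb R$, $$\mathbb E\Big[\exp\Big(i\sum_{l=1}^d\theta_l I(f_l)\Big)\Big]=\exp\Big\{-\int_{\mathbb R}\Big|\sum_{l=1}^d\theta_l f_l(x)\Big|^{\alpha(x)}dx\Big\}.$$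 Set $C(1)=\frac2\pi$ and $C(\gamma)=\dfrac{1-\gamma}{\Gamma(2-\gamma)\cos(\pi\gamma/2)}$ for $\gamma\in(0,2)\setminus\{1\}$, and for $f\in\mathcal F_\alpha$ and $\lambda>0$ set $$T_f(\lambda)=\int_{\mathbb R}\big|\lambda^{-1}f(x)\big|^{\alpha(x)}\,C(\alpha(x))\,dx.$$ Then $$\lim_{\lambda\to+\infty}\ \sup_{f\in\mathcal S_\alpha}\left|\frac{\mathbb P(|I(f)|>\lambda)}{T_f(\lambda)}-1\right|=0.$$ -/

import Mathlib

open MeasureTheory Filter Topology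

noncomputable section

namespace Multistable

/-- The modular `∫ |f(x)|^{α(x)} dx` of `f` for the variable exponent `α`. -/
def modular (α f : ℝ → ℝ) : ℝ := ∫ x : ℝ, |f x| ^ α x

/-- The variable exponent Lebesgue space `F_α`: Lebesgue measurable functions `f` with
`∫ |f(x)|^{α(x)} dx < ∞`. Its elements are functions; almost everywhere equal ones are not
identified. (For real functions, Lebesgue measurability is `AEMeasurable f volume`.) -/
def space (α : ℝ → ℝ) : Set (ℝ → ℝ) :=
  {f | AEMeasurable f volume ∧ Integrable (fun x : ℝ => |f x| ^ α x) volume}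

open Classical in
/-- The quasinorm `‖f‖_α`: the unique `r > 0` with `∫ |r⁻¹ f(x)|^{α(x)} dx = 1`, and `0` when there
is none, which for `f` in `F_α` means that `f = 0` almost everywhere. -/
def quasinorm (α f : ℝ → ℝ) : ℝ :=
  if h : ∃! r : ℝ, 0 < r ∧ modular α (fun x => r⁻¹ * f x) = 1 then h.choose else 0

/-- The unit sphere `S_α` of `F_α`, as a set of elements of `F_α`. -/
def unitSphere (α : ℝ → ℝ) : Set (space α) := {f | quasinorm α f = 1}

/-- A process `I` indexed by `F_α` is a multistable stochastic integral if its finite dimensional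
distributions have the characteristic functions
`exp (-∫ |θ₁ f₁(x) + ⋯ + θ_d f_d(x)|^{α(x)} dx)`. -/
structure IsMultistableIntegral (α : ℝ → ℝ) {Ω : Type*} [MeasurableSpace Ω] (P : Measure Ω)
    (I : space α → Ω → ℝ) : Prop where
  aemeasurable : ∀ f : space α, AEMeasurable (I f) P
  charFun_eq : ∀ (d : ℕ), 1 ≤ d → ∀ (f : Fin d → space α) (θ : Fin d → ℝ),
    ∫ ω, Complex.exp (Complex.I * ((∑ l, θ l * I (f l) ω : ℝ) : ℂ)) ∂P =
      Complex.exp (-((∫ x : ℝ, |∑ l, θ l * (f l : ℝ → ℝ) x| ^ α x : ℝ) : ℂ))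

/-- The constant `C(γ)` of the tail asymptotics. -/
def tailConst (γ : ℝ) : ℝ :=
  if γ = 1 then 2 / Real.pi
  else (1 - γ) / (Real.Gamma (2 - γ) * Real.cos (Real.pi * γ / 2))

/-- `T_f(t) = ∫ |t⁻¹ f(x)|^{α(x)} C(α(x)) dx`. -/
def tailTerm (α f : ℝ → ℝ) (t : ℝ) : ℝ := ∫ x : ℝ, |t⁻¹ * f x| ^ α x * tailConst (α x)

end Multistable

end

namespace Multistable

/-! Write `w = |f|^α`. On the unit sphere `∫ w = 1`, and `E cos(θ I(f)) = exp(-ψ(θ))` with `ψ(θ) = ∫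
w |θ|^α`; nothing else about `f` or the process is used. Let `h` be an even cutoff, equal to 1 near
the origin, with `h(x) = ∫ g(v) cos(vx) dv`. As `∫ g = h(0) = 1`, expanding `1 - exp(-y) = y +
O(y²)` gives `E[1 - h(I(f)/t)] = ∫ g(v) ψ(v/t) dv + O(Ψ²)` with `Ψ = ∫ w t^(-α)`
(`tail_functional_approx`).

By Fubini the main term is `∫ w t^(-α) M(α)`, where `M(γ) = ∫ g(v)|v|^γ dv`. The Lévy representation
of `|v|^γ` (`integral_one_sub_cos_mul_rpow`) turns `M(γ)` into `γ C(γ) ∫₀^∞ (1 - h(x)) x^(-γ-1) dx`,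
which is close to `C(γ)` when `h` is close to the indicator of `[-1, 1]` (`moment_bounds`). Two such
cutoffs, one below and one above that indicator, squeeze the tail probability.

Uniformity: `g` does not depend on `f`, `T_f(t) ≥ cΨ`, and `Ψ ≤ t^(-a)`. Hence the error relative to
`T_f(t)` is `O(t^(-a))` plus the small cutoff error (`exists_tail_ratio_bound`). -/

/-! ### The tail constant -/

/-- The reflection formula for Γ removes the apparent singularity at `γ = 1`; positivity and
continuity are then visible. -/
lemma tailConst_eq {γ : ℝ} (h0 : 0 < γ) (h2 : γ < 2) :
    tailConst γ = 2 / Real.pi * (Real.Gamma γ * Real.sin (Real.pi * γ / 2)) := by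
  unfold tailConst
  split_ifs with h1
  · subst h1; simp
  · have hs : Real.sin (Real.pi * γ / 2) ≠ 0 := by
      apply (Real.sin_pos_of_pos_of_lt_pi (by positivity) _).ne'
      nlinarith [Real.pi_pos]
    have hc : Real.cos (Real.pi * γ / 2) ≠ 0 := by
      intro hc
      obtain ⟨k, hk⟩ := Real.cos_eq_zero_iff.1 hc
      have : γ = 2 * k + 1 := by
        have hp := Real.pi_pos.ne'
        field_simp at hk
        linarith
      have hk0 : (-1 : ℝ) < k := by linarith
      have hk1 : (k : ℝ) < 1 := by linarith
      have : k = 0 := by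
        have : -1 < k := by exact_mod_cast hk0
        have : k < 1 := by exact_mod_cast hk1
        omega
      subst this
      simp_all
    have hsin : Real.sin (Real.pi * γ)
        = 2 * Real.sin (Real.pi * γ / 2) * Real.cos (Real.pi * γ / 2) := by
      rw [← Real.sin_two_mul]; ring_nf
    have hrefl := Real.Gamma_mul_Gamma_one_sub γ
    have hG : Real.Gamma (2 - γ) = (1 - γ) * Real.Gamma (1 - γ) := by
      rw [← Real.Gamma_add_one (sub_ne_zero.2 (Ne.symm h1))]; ring_nf
    have hG1 : Real.Gamma (1 - γ) ≠ 0 := by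
      intro h
      rw [h, mul_zero, hsin] at hrefl
      have : Real.pi / (2 * Real.sin (Real.pi * γ / 2) * Real.cos (Real.pi * γ / 2)) ≠ 0 := by
        have := Real.pi_pos.ne'
        positivity
      exact this hrefl.symm
    have h1' : 1 - γ ≠ 0 := sub_ne_zero.2 (Ne.symm h1)
    have hp := Real.pi_pos.ne'
    rw [hG]
    rw [hsin] at hrefl
    generalize Real.sin (Real.pi * γ / 2) = u at *
    generalize Real.cos (Real.pi * γ / 2) = v at *
    field_simp at hrefl ⊢
    linarith

lemma tailConst_pos {γ : ℝ} (h0 : 0 < γ) (h2 : γ < 2) : 0 < tailConst γ := by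
  rw [tailConst_eq h0 h2]
  have := Real.sin_pos_of_pos_of_lt_pi (x := Real.pi * γ / 2) (by positivity)
    (by nlinarith [Real.pi_pos])
  have := Real.Gamma_pos_of_pos h0
  positivity

lemma continuousOn_tailConst {a b : ℝ} (ha : 0 < a) (hb : b < 2) :
    ContinuousOn tailConst (Set.Icc a b) := by
  have h : ContinuousOn (fun γ => 2 / Real.pi * (Real.Gamma γ * Real.sin (Real.pi * γ / 2)))
      (Set.Icc a b) := by
    refine continuousOn_const.mul (ContinuousOn.mul (fun x hx => ?_) (by fun_prop))
    refine (Real.differentiableAt_Gamma fun m => ?_).continuousAt.continuousWithinAt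
    have : (0 : ℝ) ≤ m := Nat.cast_nonneg m
    have := hx.1
    intro h
    linarith
  exact h.congr fun x hx => tailConst_eq (ha.trans_le hx.1) (hx.2.trans_lt hb)

lemma aemeasurable_tailConst_comp {a b : ℝ} (ha : 0 < a) (hb : b < 2) {α : ℝ → ℝ}
    (hα : AEMeasurable α volume) (hαab : ∀ᵐ x : ℝ, α x ∈ Set.Icc a b) :
    AEMeasurable (fun x => tailConst (α x)) volume := by
  classical
  have hm : Measurable ((Set.Icc a b).piecewise tailConst fun _ => 0) :=
    (continuousOn_tailConst ha hb).measurable_piecewise continuousOn_const measurableSet_Icc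
  refine (hm.comp_aemeasurable hα).congr (hαab.mono fun x hx => ?_)
  simp [Set.piecewise_eq_of_mem _ _ _ hx]

lemma exists_tailConst_bounds {a b : ℝ} (ha : 0 < a) (hb : b < 2) :
    ∃ c K : ℝ, 0 < c ∧ ∀ γ ∈ Set.Icc a b, c ≤ tailConst γ ∧ tailConst γ ≤ K := by
  rcases (Set.Icc a b).eq_empty_or_nonempty with he | hne
  · exact ⟨1, 1, one_pos, by simp [he]⟩
  have hcont := continuousOn_tailConst ha hb
  obtain ⟨y, hy, hmin⟩ := isCompact_Icc.exists_isMinOn hne hcont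
  obtain ⟨z, -, hmax⟩ := isCompact_Icc.exists_isMaxOn hne hcont
  exact ⟨tailConst y, tailConst z, tailConst_pos (ha.trans_le hy.1) (hy.2.trans_lt hb),
    fun γ hγ => ⟨hmin hγ, hmax hγ⟩⟩

/-! ### The Lévy representation of `|v|^γ` -/

/-- Tonelli's theorem for nonnegative functions on the quadrant, in terms of real integrals. -/
lemma integral_swap_Ioi {F : ℝ → ℝ → ℝ} {A B : ℝ → ℝ} {c : ℝ}
    (hF : Measurable (Function.uncurry F))
    (hF0 : ∀ x > 0, ∀ t > 0, 0 ≤ F x t)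
    (hAi : ∀ x > 0, IntegrableOn (F x) (Set.Ioi 0))
    (hA : ∀ x > 0, ∫ t in Set.Ioi 0, F x t = A x)
    (hBi : ∀ t > 0, IntegrableOn (fun x => F x t) (Set.Ioi 0))
    (hB : ∀ t > 0, ∫ x in Set.Ioi 0, F x t = B t)
    (hBint : IntegrableOn B (Set.Ioi 0)) (hc : ∫ t in Set.Ioi 0, B t = c) :
    IntegrableOn A (Set.Ioi 0) ∧ ∫ x in Set.Ioi 0, A x = c := by
  have hA0 : ∀ x > 0, 0 ≤ A x := fun x hx => by
    rw [← hA x hx]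
    exact setIntegral_nonneg measurableSet_Ioi fun t ht => hF0 x hx t ht
  have hB0 : ∀ t > 0, 0 ≤ B t := fun t ht => by
    rw [← hB t ht]
    exact setIntegral_nonneg measurableSet_Ioi fun x hx => hF0 x hx t ht
  have e1 : ∫⁻ x in Set.Ioi 0, ENNReal.ofReal (A x)
      = ∫⁻ x in Set.Ioi (0 : ℝ), ∫⁻ t in Set.Ioi (0 : ℝ), ENNReal.ofReal (F x t) := by
    refine setLIntegral_congr_fun measurableSet_Ioi fun x hx => ?_
    rw [← hA x hx, ofReal_integral_eq_lintegral_ofReal (hAi x hx)]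
    exact (ae_restrict_mem measurableSet_Ioi).mono fun t ht => hF0 x hx t ht
  have e2 : ∫⁻ t in Set.Ioi 0, ENNReal.ofReal (B t)
      = ∫⁻ t in Set.Ioi (0 : ℝ), ∫⁻ x in Set.Ioi (0 : ℝ), ENNReal.ofReal (F x t) := by
    refine setLIntegral_congr_fun measurableSet_Ioi fun t ht => ?_
    rw [← hB t ht, ofReal_integral_eq_lintegral_ofReal (hBi t ht)]
    exact (ae_restrict_mem measurableSet_Ioi).mono fun x hx => hF0 x hx t ht
  have e3 := lintegral_lintegral_swap (μ := volume.restrict (Set.Ioi (0 : ℝ)))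
    (ν := volume.restrict (Set.Ioi (0 : ℝ))) (f := fun x t => ENNReal.ofReal (F x t))
    hF.ennreal_ofReal.aemeasurable
  have e4 := ofReal_integral_eq_lintegral_ofReal hBint
    ((ae_restrict_mem measurableSet_Ioi).mono fun t ht => hB0 t ht)
  have e5 : ∫⁻ x in Set.Ioi 0, ENNReal.ofReal (A x) = ENNReal.ofReal c := by
    rw [e1, e3, ← e2, ← e4, hc]
  have hmeas : AEStronglyMeasurable A (volume.restrict (Set.Ioi 0)) := by
    have h1 : StronglyMeasurable fun x => ∫ t in Set.Ioi 0, F x t :=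
      hF.stronglyMeasurable.integral_prod_right
    exact h1.aestronglyMeasurable.congr
      ((ae_restrict_mem measurableSet_Ioi).mono fun x hx => hA x hx)
  have hnn : 0 ≤ᵐ[volume.restrict (Set.Ioi 0)] A :=
    (ae_restrict_mem measurableSet_Ioi).mono fun x hx => hA0 x hx
  have hc0 : 0 ≤ c := by
    rw [← hc]; exact setIntegral_nonneg measurableSet_Ioi fun t ht => hB0 t ht
  refine ⟨⟨hmeas, ?_⟩, ?_⟩
  · rw [hasFiniteIntegral_iff_ofReal hnn, e5]; exact ENNReal.ofReal_lt_top
  · rw [integral_eq_lintegral_of_nonneg_ae hnn hmeas, e5, ENNReal.toReal_ofReal hc0]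

/-- Insert `1/(1+t²) = ∫ e^(-(1+t²)s) ds` and swap: the `t`-integral yields `Γ(γ/2)/2`, the
`s`-integral `Γ(1-γ/2)`, and reflection combines them. -/
lemma integral_rpow_div_one_add_sq {γ : ℝ} (h0 : 0 < γ) (h2 : γ < 2) :
    IntegrableOn (fun t : ℝ => t ^ (γ - 1) / (1 + t ^ 2)) (Set.Ioi 0) ∧
      ∫ t in Set.Ioi (0 : ℝ), t ^ (γ - 1) / (1 + t ^ 2)
        = Real.pi / (2 * Real.sin (Real.pi * γ / 2)) := by
  have hG : 0 < Real.Gamma (γ / 2) := Real.Gamma_pos_of_pos (by positivity)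
  have hG1 : 0 < Real.Gamma (1 - γ / 2) := Real.Gamma_pos_of_pos (by linarith)
  have hgam : ∫ s in Set.Ioi (0 : ℝ), Real.exp (-s) * s ^ ((1 - γ / 2) - 1)
      = Real.Gamma (1 - γ / 2) := (Real.Gamma_eq_integral (by linarith)).symm
  have hs1 : ∀ t > 0, ∫ s in Set.Ioi (0 : ℝ), t ^ (γ - 1) * Real.exp (-(1 + t ^ 2) * s)
      = t ^ (γ - 1) / (1 + t ^ 2) := fun t ht => by
    rw [integral_const_mul, integral_exp_mul_Ioi (by nlinarith)]
    simp only [mul_zero, Real.exp_zero]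
    field_simp
  have hs2 : ∀ s > 0, ∫ t in Set.Ioi (0 : ℝ), t ^ (γ - 1) * Real.exp (-(1 + t ^ 2) * s)
      = Real.exp (-s) * s ^ ((1 - γ / 2) - 1) * (Real.Gamma (γ / 2) / 2) := fun s hs => by
    have h := integral_rpow_mul_exp_neg_mul_rpow (p := 2) (q := γ - 1) (b := s) (by norm_num)
      (by linarith) hs
    have : ∀ t : ℝ, t ^ (γ - 1) * Real.exp (-(1 + t ^ 2) * s)
        = Real.exp (-s) * (t ^ (γ - 1) * Real.exp (-s * t ^ (2 : ℝ))) := fun t => by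
      rw [Real.rpow_two, mul_left_comm, ← Real.exp_add]; ring_nf
    simp_rw [this]
    rw [integral_const_mul, h, show -(γ - 1 + 1) / 2 = (1 - γ / 2) - 1 by ring,
      show (γ - 1 + 1) / 2 = γ / 2 by ring]
    ring
  refine integral_swap_Ioi (F := fun t s => t ^ (γ - 1) * Real.exp (-(1 + t ^ 2) * s))
    (B := fun s => Real.exp (-s) * s ^ ((1 - γ / 2) - 1) * (Real.Gamma (γ / 2) / 2))
    (by unfold Function.uncurry; fun_prop) (fun t ht s hs => ?_) (fun t ht => ?_) hs1
    (fun s hs => ?_) hs2 ?_ ?_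
  · have := Real.rpow_pos_of_pos ht (γ - 1)
    positivity
  -- A non-integrable function has Bochner integral 0, so a nonzero value already proves
  -- integrability.
  · refine Integrable.of_integral_ne_zero ?_
    rw [hs1 t ht]
    have := Real.rpow_pos_of_pos ht (γ - 1)
    positivity
  · refine Integrable.of_integral_ne_zero ?_
    rw [hs2 s hs]
    have := Real.rpow_pos_of_pos hs ((1 - γ / 2) - 1)
    positivity
  · refine Integrable.mul_const (Integrable.of_integral_ne_zero ?_) _
    rw [hgam]; exact hG1.ne'
  · rw [integral_mul_const, hgam]
    have := Real.Gamma_mul_Gamma_one_sub (γ / 2)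
    rw [show Real.pi * γ / 2 = Real.pi * (γ / 2) by ring]
    have hsn : Real.sin (Real.pi * (γ / 2)) ≠ 0 := by
      apply (Real.sin_pos_of_pos_of_lt_pi (by positivity) _).ne'
      nlinarith [Real.pi_pos]
    field_simp at this ⊢
    linarith

lemma integral_one_sub_cos_mul_exp {t : ℝ} (ht : 0 < t) :
    IntegrableOn (fun x : ℝ => (1 - Real.cos x) * Real.exp (-(x * t))) (Set.Ioi 0) ∧
      ∫ x in Set.Ioi (0 : ℝ), (1 - Real.cos x) * Real.exp (-(x * t)) = 1 / (t * (1 + t ^ 2)) := by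
  have ha : ((-t : ℝ) + Complex.I : ℂ).re < 0 := by simpa
  have hi := integrableOn_exp_mul_complex_Ioi ha 0
  have he := integral_exp_mul_complex_Ioi ha 0
  have hre : ∀ x : ℝ, RCLike.re (Complex.exp (((-t : ℝ) + Complex.I : ℂ) * x))
      = Real.cos x * Real.exp (-(x * t)) := fun x => by
    simp [Complex.exp_re, mul_comm]
  have hi2 : IntegrableOn (fun x : ℝ => Real.cos x * Real.exp (-(x * t))) (Set.Ioi 0) :=
    hi.re.congr (Eventually.of_forall hre)
  have he2 : ∫ x in Set.Ioi (0 : ℝ), Real.cos x * Real.exp (-(x * t)) = t / (1 + t ^ 2) := by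
    have h3 := integral_re hi
    rw [he] at h3
    simp_rw [hre] at h3
    rw [h3]
    simp [Complex.normSq_apply, Complex.div_re]
    ring
  have hi1 : IntegrableOn (fun x : ℝ => Real.exp (-(x * t))) (Set.Ioi 0) := by
    have := integrableOn_exp_mul_Ioi (a := -t) (by linarith) 0
    refine this.congr (Eventually.of_forall fun x => ?_)
    simp [mul_comm]
  have he1 : ∫ x in Set.Ioi (0 : ℝ), Real.exp (-(x * t)) = 1 / t := by
    have := integral_exp_mul_Ioi (a := -t) (by linarith) 0
    simp only [mul_zero, Real.exp_zero] at this
    rw [neg_div_neg_eq] at this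
    rw [← this]
    congr 1; ext x; ring_nf
  have hsplit : (fun x : ℝ => (1 - Real.cos x) * Real.exp (-(x * t)))
      = fun x => Real.exp (-(x * t)) - Real.cos x * Real.exp (-(x * t)) := by
    ext x; ring
  rw [hsplit]
  refine ⟨hi1.sub hi2, ?_⟩
  rw [integral_sub hi1 hi2, he1, he2]
  field_simp
  ring

/-- Insert `Γ(γ+1) x^(-γ-1) = ∫ t^γ e^(-xt) dt` and swap. The Laplace transform of `1 - cos` leaves
`∫ t^(γ-1)/(1+t²) dt`. -/
lemma integral_one_sub_cos_rpow {γ : ℝ} (h0 : 0 < γ) (h2 : γ < 2) :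
    IntegrableOn (fun x : ℝ => (1 - Real.cos x) * x ^ (-γ - 1)) (Set.Ioi 0) ∧
      ∫ x in Set.Ioi (0 : ℝ), (1 - Real.cos x) * x ^ (-γ - 1) = 1 / (γ * tailConst γ) := by
  have hG : 0 < Real.Gamma (γ + 1) := Real.Gamma_pos_of_pos (by positivity)
  obtain ⟨i1, e1⟩ := integral_rpow_div_one_add_sq h0 h2
  have hgam : ∀ x > 0, ∫ t in Set.Ioi (0 : ℝ), t ^ γ * Real.exp (-(x * t))
      = x ^ (-γ - 1) * Real.Gamma (γ + 1) := fun x hx => by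
    have := Real.integral_rpow_mul_exp_neg_mul_Ioi (a := γ + 1) (r := x) (by linarith) hx
    simp only [add_sub_cancel_right] at this
    rw [this, one_div, Real.inv_rpow hx.le, ← Real.rpow_neg hx.le]
    ring_nf
  have key := integral_swap_Ioi
    (F := fun x t => (1 - Real.cos x) * (t ^ γ * Real.exp (-(x * t))))
    (A := fun x => (1 - Real.cos x) * (x ^ (-γ - 1) * Real.Gamma (γ + 1)))
    (B := fun t => t ^ (γ - 1) / (1 + t ^ 2))
    (by unfold Function.uncurry; fun_prop)
    (fun x hx t ht => by
      have := Real.cos_le_one x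
      have := Real.rpow_pos_of_pos ht γ
      have : 0 ≤ 1 - Real.cos x := by linarith
      positivity)
    (fun x hx => by
      refine Integrable.const_mul (Integrable.of_integral_ne_zero ?_) _
      rw [hgam x hx]
      have := Real.rpow_pos_of_pos hx (-γ - 1)
      positivity)
    (fun x hx => by rw [integral_const_mul, hgam x hx])
    (fun t ht => by
      refine ((integral_one_sub_cos_mul_exp ht).1.const_mul (t ^ γ)).congr
        (Eventually.of_forall fun x => ?_)
      simp only; ring)
    (fun t ht => by
      simp_rw [mul_left_comm _ (t ^ γ)]
      rw [integral_const_mul, (integral_one_sub_cos_mul_exp ht).2, Real.rpow_sub_one ht.ne']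
      field_simp) i1 e1
  obtain ⟨k1, k2⟩ := key
  have hA : (fun x : ℝ => (1 - Real.cos x) * (x ^ (-γ - 1) * Real.Gamma (γ + 1)))
      = fun x => (1 - Real.cos x) * x ^ (-γ - 1) * Real.Gamma (γ + 1) := by ext; ring
  rw [hA] at k1 k2
  rw [integral_mul_const] at k2
  refine ⟨?_, ?_⟩
  · refine (k1.mul_const (Real.Gamma (γ + 1))⁻¹).congr (Eventually.of_forall fun x => ?_)
    simp only
    field_simp
  · rw [tailConst_eq h0 h2]
    rw [Real.Gamma_add_one h0.ne'] at k2
    have hG' := Real.Gamma_pos_of_pos h0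
    have hp := Real.pi_pos
    have hsn : 0 < Real.sin (Real.pi * γ / 2) := by
      apply (Real.sin_pos_of_pos_of_lt_pi (by positivity) _)
      nlinarith [Real.pi_pos]
    rw [eq_div_iff (by positivity)]
    generalize Real.sin (Real.pi * γ / 2) = u at *
    field_simp at k2 ⊢
    linarith

lemma integral_one_sub_cos_mul_rpow {γ : ℝ} (h0 : 0 < γ) (h2 : γ < 2) (v : ℝ) :
    IntegrableOn (fun x : ℝ => (1 - Real.cos (v * x)) * x ^ (-γ - 1)) (Set.Ioi 0) ∧
      ∫ x in Set.Ioi (0 : ℝ), (1 - Real.cos (v * x)) * x ^ (-γ - 1)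
        = |v| ^ γ * (1 / (γ * tailConst γ)) := by
  rcases eq_or_ne v 0 with rfl | hv
  · simp [h0.ne']
  have hv' : 0 < |v| := abs_pos.2 hv
  have hcos : ∀ x, Real.cos (v * x) = Real.cos (|v| * x) := fun x => by
    rcases abs_choice v with h | h <;> rw [h]
    rw [neg_mul, Real.cos_neg]
  obtain ⟨i, e⟩ := integral_one_sub_cos_rpow h0 h2
  have hcongr : Set.EqOn (fun x : ℝ => (1 - Real.cos (v * x)) * x ^ (-γ - 1))
      (fun x => |v| ^ (γ + 1) * ((1 - Real.cos (|v| * x)) * (|v| * x) ^ (-γ - 1)))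
      (Set.Ioi 0) := fun x hx => by
    have hx' : (0 : ℝ) < x := hx
    simp only
    rw [hcos, Real.mul_rpow hv'.le hx'.le,
      show -γ - 1 = -(γ + 1) by ring, Real.rpow_neg hv'.le]
    have := (Real.rpow_pos_of_pos hv' (γ + 1)).ne'
    field_simp
  have i' : IntegrableOn (fun x => (1 - Real.cos (|v| * x)) * (|v| * x) ^ (-γ - 1))
      (Set.Ioi 0) := by
    have := (integrableOn_Ioi_comp_mul_left_iff
      (fun x => (1 - Real.cos x) * x ^ (-γ - 1)) 0 hv').2 (by simpa using i)
    exact this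
  refine ⟨IntegrableOn.congr_fun (i'.const_mul _) hcongr.symm measurableSet_Ioi, ?_⟩
  rw [setIntegral_congr_fun measurableSet_Ioi hcongr, integral_const_mul,
    integral_comp_mul_left_Ioi (fun x => (1 - Real.cos x) * x ^ (-γ - 1)) 0 hv', mul_zero, e,
    Real.rpow_add_one hv'.ne', smul_eq_mul]
  field_simp

/-! ### Smooth cutoffs and the moments of their cosine transforms -/

open FourierTransform in
/-- Smooth even cutoff functions are cosine transforms of rapidly decreasing functions. -/
lemma exists_cutoff {r R : ℝ} (hr : 0 < r) (hrR : r < R) :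
    ∃ h g : ℝ → ℝ, Continuous h ∧ (∀ x, 0 ≤ h x) ∧ (∀ x, h x ≤ 1) ∧ (∀ x, |x| ≤ r → h x = 1) ∧
      (∀ x, R ≤ |x| → h x = 0) ∧ Continuous g ∧ Integrable (fun v => |g v| * (1 + v ^ 2) ^ 2) ∧
      ∀ x, h x = ∫ v, g v * Real.cos (v * x) := by
  let B : ContDiffBump (0 : ℝ) := ⟨r, R, hr, hrR⟩
  have hcs : HasCompactSupport (fun x => (B x : ℂ)) :=
    B.hasCompactSupport.comp_left (g := ((↑) : ℝ → ℂ)) Complex.ofReal_zero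
  have hsm : ContDiff ℝ (⊤ : ℕ∞) (fun x => (B x : ℂ)) :=
    Complex.ofRealCLM.contDiff.comp B.contDiff
  let S : SchwartzMap ℝ ℂ := hcs.toSchwartzMap hsm
  let F : SchwartzMap ℝ ℂ := 𝓕 S
  have hSF : ∀ x, (B x : ℂ) = ∫ v : ℝ, Complex.exp ((2 * Real.pi * (x * v) : ℝ) * Complex.I) * F v :=
    fun x => by
      have h1 : 𝓕⁻ F = S := fourierInv_fourier_eq S
      have h2 : (𝓕⁻ F : SchwartzMap ℝ ℂ) x = (B x : ℂ) := by rw [h1]; rfl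
      rw [← h2, SchwartzMap.fourierInv_coe, Real.fourierInv_eq']
      simp
  have hFi : Integrable (fun v => F v) := F.integrable
  have hint : ∀ x, Integrable
      (fun v : ℝ => Complex.exp ((2 * Real.pi * (x * v) : ℝ) * Complex.I) * F v) := fun x => by
    refine hFi.bdd_mul (c := 1) (by fun_prop) (Eventually.of_forall fun v => ?_)
    rw [Complex.norm_exp_ofReal_mul_I]
  have hre : ∀ x, B x = ∫ v : ℝ, (Real.cos (2 * Real.pi * (x * v)) * (F v).re
      - Real.sin (2 * Real.pi * (x * v)) * (F v).im) := fun x => by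
    have h1 := integral_re (hint x)
    rw [← hSF x] at h1
    simp only [RCLike.re_to_complex, Complex.ofReal_re] at h1
    rw [← h1]
    refine integral_congr_ae (Eventually.of_forall fun v => ?_)
    simp only [Complex.mul_re, Complex.exp_ofReal_mul_I_re, Complex.exp_ofReal_mul_I_im]
  have hreint : ∀ x, Integrable fun v : ℝ => (Real.cos (2 * Real.pi * (x * v)) * (F v).re
      - Real.sin (2 * Real.pi * (x * v)) * (F v).im) := fun x => by
    refine (hint x).re.congr (Eventually.of_forall fun v => ?_)
    simp only [RCLike.re_to_complex, Complex.mul_re, Complex.exp_ofReal_mul_I_re,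
      Complex.exp_ofReal_mul_I_im]
  -- The bump is even, so averaging over `x` and `-x` cancels the sine part.
  have hcos : ∀ x, B x = ∫ v : ℝ, (F v).re * Real.cos (2 * Real.pi * (x * v)) := fun x => by
    have h1 := hre (-x)
    rw [B.neg] at h1
    have h2 : B x = (B x + B x) / 2 := by ring
    rw [h2]
    nth_rw 1 [hre x]
    rw [h1, ← integral_add (hreint x) (hreint (-x)), ← integral_div]
    refine integral_congr_ae (Eventually.of_forall fun v => ?_)
    simp only [neg_mul, mul_neg, Real.cos_neg, Real.sin_neg]
    ring
  have h2pi : (0 : ℝ) < 2 * Real.pi := by positivity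
  have hFw : Integrable fun v : ℝ => |(F v).re| * (1 + (2 * Real.pi * v) ^ 2) ^ 2 := by
    have i0 := F.integrable_pow_mul volume 0
    have i2 := (F.integrable_pow_mul volume 2).const_mul (2 * (2 * Real.pi) ^ 2)
    have i4 := (F.integrable_pow_mul volume 4).const_mul ((2 * Real.pi) ^ 4)
    refine ((i0.add i2).add i4).mono' ?_ (Eventually.of_forall fun v => ?_)
    · have hc : Continuous fun v : ℝ => |(F v).re| * (1 + (2 * Real.pi * v) ^ 2) ^ 2 := by
        have := F.continuous
        fun_prop
      exact hc.aestronglyMeasurable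
    · rw [Real.norm_of_nonneg (by positivity)]
      have h1 : |(F v).re| ≤ ‖F v‖ := Complex.abs_re_le_norm _
      have h2 : |v| ^ 2 = v ^ 2 := sq_abs v
      have h4 : |v| ^ 4 = v ^ 4 := by rw [show 4 = 2 * 2 by rfl, pow_mul, pow_mul, h2]
      simp only [Pi.add_apply, Real.norm_eq_abs, h2, h4, pow_zero]
      calc |(F v).re| * (1 + (2 * Real.pi * v) ^ 2) ^ 2
          ≤ ‖F v‖ * (1 + (2 * Real.pi * v) ^ 2) ^ 2 := by gcongr
        _ = _ := by ring
  -- The rescaling absorbs the `2π` in the normalisation of the Fourier transform.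
  refine ⟨B, fun v => (2 * Real.pi)⁻¹ * (F ((2 * Real.pi)⁻¹ * v)).re, B.continuous,
    fun x => B.nonneg, fun x => B.le_one, fun x hx => ?_, fun x hx => ?_, ?_, ?_, fun x => ?_⟩
  · exact B.one_of_mem_closedBall (by simpa using hx)
  · exact B.zero_of_le_dist (by simpa using hx)
  · have := F.continuous
    fun_prop
  · refine ((hFw.comp_mul_left' (inv_ne_zero h2pi.ne')).const_mul (2 * Real.pi)⁻¹).congr
      (Eventually.of_forall fun v => ?_)
    simp only
    rw [abs_mul, abs_of_pos (inv_pos.2 h2pi), mul_inv_cancel_left₀ h2pi.ne']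
    ring
  · have := Measure.integral_comp_mul_left
      (fun v => (F v).re * Real.cos (2 * Real.pi * (x * v))) (2 * Real.pi)⁻¹
    rw [hcos x, ← inv_inv (2 * Real.pi)]
    simp_rw [mul_assoc]
    rw [integral_const_mul]
    have h3 : ∀ v : ℝ, Real.cos (v * x) = Real.cos (2 * Real.pi * (x * ((2 * Real.pi)⁻¹ * v))) :=
      fun v => by
        congr 1
        field_simp
    simp_rw [inv_inv, h3]
    rw [this, inv_inv, abs_of_pos h2pi, smul_eq_mul, inv_mul_cancel_left₀ h2pi.ne']

lemma abs_rpow_le {γ : ℝ} (h0 : 0 ≤ γ) (h2 : γ ≤ 2) (v : ℝ) : |v| ^ γ ≤ 1 + v ^ 2 := by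
  rcases le_total |v| 1 with h | h
  · have := Real.rpow_le_one (abs_nonneg v) h h0
    nlinarith [sq_nonneg v]
  · have := Real.rpow_le_rpow_of_exponent_le h h2
    rw [Real.rpow_two, sq_abs] at this
    linarith

lemma one_add_sq_le_sq (v : ℝ) : 1 + v ^ 2 ≤ (1 + v ^ 2) ^ 2 := by
  nlinarith [sq_nonneg v, sq_nonneg (v ^ 2)]

lemma integrable_mul_of_abs_le {g k : ℝ → ℝ} (hg : Continuous g)
    (hgi : Integrable (fun v => |g v| * (1 + v ^ 2) ^ 2)) (hk : AEStronglyMeasurable k volume)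
    (hle : ∀ v, |k v| ≤ (1 + v ^ 2) ^ 2) : Integrable fun v => g v * k v := by
  refine hgi.mono' (hg.aestronglyMeasurable.mul hk) (Eventually.of_forall fun v => ?_)
  rw [Real.norm_eq_abs, abs_mul]
  exact mul_le_mul_of_nonneg_left (hle v) (abs_nonneg _)

lemma integrable_mul_abs_rpow {g : ℝ → ℝ} (hg : Continuous g)
    (hgi : Integrable (fun v => |g v| * (1 + v ^ 2) ^ 2)) {γ : ℝ} (h0 : 0 ≤ γ) (h2 : γ ≤ 2) :
    Integrable fun v => g v * |v| ^ γ := by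
  refine integrable_mul_of_abs_le hg hgi
    (Measurable.aestronglyMeasurable (by fun_prop)) fun v => ?_
  rw [abs_of_nonneg (by positivity)]
  exact (abs_rpow_le h0 h2 v).trans (one_add_sq_le_sq v)

/-- Integrating the Lévy representation of `|v|^γ` against `g` gives `γ C(γ) ∫₀^∞ (1 - h(x))
x^(-γ-1) dx`. Here `1 - h` lies between the indicators of `x > R` and `x > r`, whose integrals are
`R^(-γ)/γ` and `r^(-γ)/γ`. -/
lemma moment_bounds {h g : ℝ → ℝ} {r R : ℝ} (hr : 0 < r) (hrR : r < R)
    (h0 : ∀ x, 0 ≤ h x) (h1 : ∀ x, h x ≤ 1) (hin : ∀ x, |x| ≤ r → h x = 1)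
    (hout : ∀ x, R ≤ |x| → h x = 0) (hg : Continuous g)
    (hgi : Integrable (fun v => |g v| * (1 + v ^ 2) ^ 2))
    (hh : ∀ x, h x = ∫ v, g v * Real.cos (v * x)) {γ : ℝ} (hγ0 : 0 < γ) (hγ2 : γ < 2) :
    tailConst γ * R ^ (-γ) ≤ ∫ v, g v * |v| ^ γ ∧
      ∫ v, g v * |v| ^ γ ≤ tailConst γ * r ^ (-γ) := by
  have hR : 0 < R := hr.trans hrR
  have hC := tailConst_pos hγ0 hγ2
  have hgint : Integrable fun v => g v := by
    simpa using integrable_mul_of_abs_le hg hgi (k := fun _ => 1) (by fun_prop)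
      (fun v => by rw [abs_one]; nlinarith [sq_nonneg v, sq_nonneg (v ^ 2)])
  have hgcos : ∀ x, Integrable fun v => g v * Real.cos (v * x) := fun x => by
    refine integrable_mul_of_abs_le hg hgi (by fun_prop) fun v => ?_
    have := Real.abs_cos_le_one (v * x)
    nlinarith [sq_nonneg v, sq_nonneg (v ^ 2)]
  have hone : 1 - h 0 = 0 := by rw [hin 0 (by simpa using hr.le), sub_self]
  have hsub : ∀ x, 1 - h x = ∫ v, g v * (1 - Real.cos (v * x)) := fun x => by
    have e : h 0 = ∫ v, g v := by simpa using hh 0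
    have : (1 : ℝ) = ∫ v, g v := by linarith
    simp_rw [mul_sub, mul_one]
    rw [integral_sub hgint (hgcos x), ← this, ← hh x]
  let Φ : ℝ → ℝ → ℝ := fun v x => g v * ((1 - Real.cos (v * x)) * x ^ (-γ - 1))
  have hΦm : Measurable (Function.uncurry Φ) := by
    have := hg.measurable
    simp only [Function.uncurry_def, Φ]
    fun_prop
  -- Since `1 - cos ≥ 0`, the inner integral of the absolute value is computed exactly, a constant
  -- times `|g(v)| |v|^γ`.
  have hΦ : Integrable (Function.uncurry Φ) (volume.prod (volume.restrict (Set.Ioi 0))) := by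
    rw [integrable_prod_iff hΦm.aestronglyMeasurable]
    refine ⟨Eventually.of_forall fun v => ((integral_one_sub_cos_mul_rpow hγ0 hγ2 v).1.const_mul (g v) :), ?_⟩
    have : ∀ v, ∫ x in Set.Ioi (0 : ℝ), ‖Function.uncurry Φ (v, x)‖
        = ‖g v * |v| ^ γ‖ * (1 / (γ * tailConst γ)) := fun v => by
      rw [norm_mul, mul_assoc, Real.norm_of_nonneg (Real.rpow_nonneg (abs_nonneg v) γ),
        ← (integral_one_sub_cos_mul_rpow hγ0 hγ2 v).2, ← integral_const_mul]
      refine setIntegral_congr_fun measurableSet_Ioi fun x hx => ?_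
      have hx' : (0 : ℝ) < x := hx
      have := Real.cos_le_one (v * x)
      have h2 := Real.rpow_pos_of_pos hx' (-γ - 1)
      simp only [Function.uncurry_def, Φ, norm_mul]
      rw [Real.norm_of_nonneg h2.le, Real.norm_of_nonneg (sub_nonneg.2 this)]
    simp_rw [this]
    exact (integrable_mul_abs_rpow hg hgi hγ0.le hγ2.le).norm.mul_const _
  have hinner : ∀ x, ∫ v, Φ v x = (1 - h x) * x ^ (-γ - 1) := fun x => by
    rw [hsub x, ← integral_mul_const]
    simp only [Φ, mul_assoc]
  have hMi : IntegrableOn (fun x => (1 - h x) * x ^ (-γ - 1)) (Set.Ioi 0) :=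
    hΦ.integral_prod_right.congr (Eventually.of_forall hinner)
  have hM : ∫ x in Set.Ioi (0 : ℝ), (1 - h x) * x ^ (-γ - 1)
      = (∫ v, g v * |v| ^ γ) * (1 / (γ * tailConst γ)) := by
    simp_rw [← hinner]
    rw [← integral_integral_swap hΦ, ← integral_mul_const]
    refine integral_congr_ae (Eventually.of_forall fun v => ?_)
    simp only [Φ]
    rw [integral_const_mul, (integral_one_sub_cos_mul_rpow hγ0 hγ2 v).2, mul_assoc]
  have hpow : ∀ c > 0, IntegrableOn (fun x : ℝ => x ^ (-γ - 1)) (Set.Ioi c) ∧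
      ∫ x in Set.Ioi c, x ^ (-γ - 1) = c ^ (-γ) / γ := fun c hc => by
    refine ⟨integrableOn_Ioi_rpow_of_lt (by linarith) hc, ?_⟩
    rw [integral_Ioi_rpow_of_lt (by linarith) hc, sub_add_cancel, neg_div_neg_eq]
  have hle : ∫ x in Set.Ioi (0 : ℝ), (1 - h x) * x ^ (-γ - 1) ≤ r ^ (-γ) / γ := by
    rw [← (hpow r hr).2]
    have hz : ∀ x ∈ Set.Ioi (0 : ℝ) \ Set.Ioi r, (1 - h x) * x ^ (-γ - 1) = 0 := fun x hx => by
      have hx0 : (0 : ℝ) < x := hx.1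
      have hxr : x ≤ r := not_lt.1 hx.2
      rw [hin x (by rwa [abs_of_pos hx0]), sub_self, zero_mul]
    rw [setIntegral_eq_of_subset_of_forall_sdiff_eq_zero measurableSet_Ioi
      (Set.Ioi_subset_Ioi hr.le) hz]
    refine setIntegral_mono_on (hMi.mono_set (Set.Ioi_subset_Ioi hr.le)) (hpow r hr).1
      measurableSet_Ioi fun x hx => ?_
    have hx' : 0 < x := hr.trans hx
    have := h0 x
    have := Real.rpow_nonneg hx'.le (-γ - 1)
    nlinarith
  have hge : R ^ (-γ) / γ ≤ ∫ x in Set.Ioi (0 : ℝ), (1 - h x) * x ^ (-γ - 1) := by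
    rw [← (hpow R hR).2]
    calc ∫ x in Set.Ioi R, x ^ (-γ - 1) = ∫ x in Set.Ioi R, (1 - h x) * x ^ (-γ - 1) :=
          setIntegral_congr_fun measurableSet_Ioi fun x hx => by
            have hx' : R < x := hx
            simp [hout x (hx'.le.trans (le_abs_self x))]
      _ ≤ _ := setIntegral_mono_set hMi
          ((ae_restrict_mem measurableSet_Ioi).mono fun x hx => by
            have hx' : (0 : ℝ) < x := hx
            have := h1 x
            exact mul_nonneg (by linarith) (Real.rpow_nonneg hx'.le _))
          (Set.Ioi_subset_Ioi hR.le).eventuallyLE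
  rw [hM] at hle hge
  constructor
  · field_simp at hge; linarith
  · field_simp at hle; linarith

/-! ### Linearising the characteristic function -/

lemma abs_one_sub_exp_neg_sub_le {y : ℝ} (hy : 0 ≤ y) : |1 - Real.exp (-y) - y| ≤ y ^ 2 := by
  rcases le_total y 1 with h | h
  · have := Real.abs_exp_sub_one_sub_id_le (x := -y) (by rwa [abs_neg, abs_of_nonneg hy])
    rw [← abs_neg, neg_sq] at this
    convert this using 2
    ring
  · have h1 := Real.one_sub_le_exp_neg y
    have h2 : Real.exp (-y) ≤ 1 := Real.exp_le_one_iff.2 (by linarith)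
    rw [abs_le]
    constructor <;> nlinarith

lemma integral_cos_eq {α : ℝ → ℝ} {Ω : Type*} [MeasurableSpace Ω] {P : Measure Ω}
    [IsProbabilityMeasure P] {I : space α → Ω → ℝ} (hI : IsMultistableIntegral α P I)
    (f : space α) (θ : ℝ) :
    ∫ x, Real.cos (θ * x) ∂(P.map (I f))
      = Real.exp (-∫ x : ℝ, |(f : ℝ → ℝ) x| ^ α x * |θ| ^ α x) := by
  rw [integral_map (hI.aemeasurable f) (by fun_prop)]
  have h := hI.charFun_eq 1 le_rfl (fun _ => f) (fun _ => θ)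
  simp only [Finset.univ_unique, Fin.default_eq_zero, Fin.isValue, Finset.sum_const,
    Finset.card_singleton, one_smul] at h
  have hint : Integrable (fun ω => Complex.exp (Complex.I * ((θ * I f ω : ℝ) : ℂ))) P := by
    refine Integrable.of_bound (C := 1) ?_ (Eventually.of_forall fun ω => ?_)
    · have : AEMeasurable (fun ω => Complex.exp (Complex.I * ((θ * I f ω : ℝ) : ℂ))) P := by
        have := hI.aemeasurable f
        fun_prop
      exact this.aestronglyMeasurable
    · rw [mul_comm, Complex.norm_exp_ofReal_mul_I]
  have h1 := integral_re hint
  rw [h] at h1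
  have h2 : ∀ x, |θ * (f : ℝ → ℝ) x| ^ α x = |(f : ℝ → ℝ) x| ^ α x * |θ| ^ α x := fun x => by
    rw [abs_mul, Real.mul_rpow (abs_nonneg _) (abs_nonneg _), mul_comm]
  simp_rw [h2] at h1
  rw [← Complex.ofReal_neg, ← Complex.ofReal_exp] at h1
  simp only [RCLike.re_to_complex, Complex.ofReal_re] at h1
  rw [← h1]
  refine integral_congr_ae (Eventually.of_forall fun ω => ?_)
  simp only
  rw [mul_comm Complex.I, Complex.exp_ofReal_mul_I_re]

section

variable {a b : ℝ} {α w : ℝ → ℝ}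

lemma integrable_mul_rpow_neg (ha : 0 < a) (hα : AEMeasurable α volume)
    (hαab : ∀ᵐ x : ℝ, α x ∈ Set.Icc a b) (hw : Integrable w) {t : ℝ} (ht : 1 ≤ t) :
    Integrable fun x => w x * t ^ (-α x) := by
  refine hw.mul_bdd (c := 1) (AEMeasurable.aestronglyMeasurable (by fun_prop)) (hαab.mono fun x hx => ?_)
  have ht0 : 0 < t := by linarith
  rw [Real.norm_of_nonneg (by positivity)]
  exact Real.rpow_le_one_of_one_le_of_nonpos ht (by linarith [hx.1])

/-- The bound `|v|^γ ≤ 1 + v²` on `0 ≤ γ ≤ 2` gives `ψ(v/t) ≤ (1 + v²)Ψ`. Squaring this in the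
remainder of `1 - exp(-ψ)` is what calls for the weight `(1 + v²)²` on `g`. -/
lemma tail_functional_approx {μ : Measure ℝ} [IsProbabilityMeasure μ] (ha : 0 < a) (hb : b < 2)
    (hα : AEMeasurable α volume) (hαab : ∀ᵐ x : ℝ, α x ∈ Set.Icc a b) (hw : Integrable w)
    (hw0 : ∀ x, 0 ≤ w x)
    (hμ : ∀ θ, ∫ x, Real.cos (θ * x) ∂μ = Real.exp (-∫ x, w x * |θ| ^ α x))
    {h g : ℝ → ℝ} (hhc : Continuous h) (hh0 : ∀ x, 0 ≤ h x) (hh1 : ∀ x, h x ≤ 1) (hz : h 0 = 1)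
    (hg : Continuous g)
    (hgi : Integrable (fun v => |g v| * (1 + v ^ 2) ^ 2))
    (hh : ∀ x, h x = ∫ v, g v * Real.cos (v * x)) {t : ℝ} (ht : 1 ≤ t) :
    Integrable (fun x => w x * t ^ (-α x) * ∫ v, g v * |v| ^ α x) ∧
    |∫ x, (1 - h (x / t)) ∂μ - ∫ x, w x * t ^ (-α x) * ∫ v, g v * |v| ^ α x|
      ≤ (∫ v, |g v| * (1 + v ^ 2) ^ 2) * (∫ x, w x * t ^ (-α x)) ^ 2 := by
  have ht0 : 0 < t := by linarith
  set ψ : ℝ → ℝ := fun θ => ∫ x, w x * |θ| ^ α x with hψ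
  set Ψ : ℝ := ∫ x, w x * t ^ (-α x) with hΨ
  have hwt := integrable_mul_rpow_neg ha hα hαab hw ht
  have hgint : Integrable fun v => g v := by
    simpa using integrable_mul_of_abs_le hg hgi (k := fun _ => 1) (by fun_prop)
      (fun v => by rw [abs_one]; nlinarith [sq_nonneg v, sq_nonneg (v ^ 2)])
  have hscale : ∀ v x, w x * |v / t| ^ α x = w x * t ^ (-α x) * |v| ^ α x := fun v x => by
    rw [abs_div, abs_of_pos ht0, Real.div_rpow (abs_nonneg v) ht0.le, Real.rpow_neg ht0.le]
    ring
  have hψ0 : ∀ θ, 0 ≤ ψ θ := fun θ =>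
    integral_nonneg fun x => mul_nonneg (hw0 x) (by positivity)
  have hψle : ∀ v, ψ (v / t) ≤ (1 + v ^ 2) * Ψ := fun v => by
    rw [hψ, hΨ, ← integral_const_mul]
    refine integral_mono_of_nonneg
      (Eventually.of_forall fun x => mul_nonneg (hw0 x) (by positivity))
      (hwt.const_mul _) (hαab.mono fun x hx => ?_)
    simp only
    rw [hscale, mul_comm (1 + v ^ 2)]
    exact mul_le_mul_of_nonneg_left
      (abs_rpow_le (ha.le.trans hx.1) (hx.2.trans hb.le) v)
      (mul_nonneg (hw0 x) (by positivity))
  -- the smoothed tail in terms of the characteristic function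
  have hcosint : Integrable (Function.uncurry fun x v : ℝ => g v * Real.cos (v * (x / t)))
      (μ.prod volume) := by
    have h1 : Integrable (fun z : ℝ × ℝ => (1 : ℝ) * g z.2) (μ.prod volume) :=
      (integrable_const (1 : ℝ)).mul_prod hgint
    refine h1.norm.mono' ?_ (Eventually.of_forall fun z => ?_)
    · exact Continuous.aestronglyMeasurable (by unfold Function.uncurry; fun_prop)
    · simp only [Function.uncurry_def, norm_mul, one_mul]
      exact mul_le_of_le_one_right (norm_nonneg _) (Real.abs_cos_le_one _)
  have hinner : ∀ v, ∫ x, g v * Real.cos (v * (x / t)) ∂μ = g v * Real.exp (-ψ (v / t)) :=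
    fun v => by
      rw [integral_const_mul, hψ, ← hμ]
      congr 2
      ext x
      ring_nf
  have hEi : Integrable fun v => g v * Real.exp (-ψ (v / t)) :=
    hcosint.integral_prod_right.congr (Eventually.of_forall hinner)
  have hE : ∫ x, h (x / t) ∂μ = ∫ v, g v * Real.exp (-ψ (v / t)) := by
    simp_rw [hh]
    rw [integral_integral_swap hcosint]
    simp_rw [hinner]
  have hone : (1 : ℝ) = ∫ v, g v := by rw [← hz, hh 0]; simp
  have hhint : Integrable (fun x => h (x / t)) μ := by
    refine Integrable.of_bound (C := 1) (Continuous.aestronglyMeasurable (by fun_prop))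
      (Eventually.of_forall fun x => ?_)
    rw [Real.norm_of_nonneg (hh0 _)]
    exact hh1 _
  have hE1 : ∫ x, (1 - h (x / t)) ∂μ = ∫ v, (g v - g v * Real.exp (-ψ (v / t))) := by
    rw [integral_sub (integrable_const _) hhint, integral_sub hgint hEi, hE, ← hone]
    simp
  -- the main term
  have hprod : Integrable (Function.uncurry fun v x : ℝ => g v * (w x * t ^ (-α x) * |v| ^ α x))
      (volume.prod volume) := by
    have h1 : Integrable (fun z : ℝ × ℝ => (|g z.1| * (1 + z.1 ^ 2) ^ 2) * (w z.2 * t ^ (-α z.2)))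
      (volume.prod volume) := hgi.mul_prod hwt
    refine h1.mono' ?_ ?_
    · have m1 : AEMeasurable (fun z : ℝ × ℝ => w z.2) (volume.prod volume) :=
        hw.aemeasurable.comp_snd
      have m2 : AEMeasurable (fun z : ℝ × ℝ => α z.2) (volume.prod volume) := hα.comp_snd
      have m3 : Measurable g := hg.measurable
      have : AEMeasurable
          (fun z : ℝ × ℝ => g z.1 * (w z.2 * t ^ (-α z.2) * |z.1| ^ α z.2))
          (volume.prod volume) := by
        fun_prop
      exact this.aestronglyMeasurable
    · filter_upwards [Measure.quasiMeasurePreserving_snd.ae hαab] with z hx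
      have hnn : 0 ≤ w z.2 * t ^ (-α z.2) := mul_nonneg (hw0 _) (by positivity)
      have h3 : |z.1| ^ α z.2 ≤ (1 + z.1 ^ 2) ^ 2 :=
        (abs_rpow_le (ha.le.trans hx.1) (hx.2.trans hb.le) z.1).trans (one_add_sq_le_sq _)
      simp only [Function.uncurry_def]
      rw [norm_mul, Real.norm_of_nonneg (mul_nonneg hnn (by positivity)), Real.norm_eq_abs,
        mul_assoc |g z.1|, mul_comm ((1 + z.1 ^ 2) ^ 2)]
      gcongr
  have hin1 : ∀ v, ∫ x, g v * (w x * t ^ (-α x) * |v| ^ α x) = g v * ψ (v / t) := fun v => by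
    rw [integral_const_mul, hψ]
    simp only [hscale]
  have hin2 : ∀ x, ∫ v, g v * (w x * t ^ (-α x) * |v| ^ α x)
      = w x * t ^ (-α x) * ∫ v, g v * |v| ^ α x := fun x => by
    simp_rw [mul_left_comm (g _)]
    rw [integral_const_mul]
  have hψi : Integrable fun v => g v * ψ (v / t) :=
    hprod.integral_prod_left.congr (Eventually.of_forall hin1)
  have hmain : ∫ x, w x * t ^ (-α x) * ∫ v, g v * |v| ^ α x = ∫ v, g v * ψ (v / t) := by
    simp_rw [← hin2, ← hin1]
    rw [integral_integral_swap hprod]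
  refine ⟨hprod.integral_prod_right.congr (Eventually.of_forall hin2), ?_⟩
  rw [hE1, hmain, ← integral_sub (f := fun v => g v - g v * Real.exp (-ψ (v / t))) (hgint.sub hEi) hψi,
    ← integral_mul_const, ← Real.norm_eq_abs]
  refine norm_integral_le_of_norm_le (hgi.mul_const _) (Eventually.of_forall fun v => ?_)
  have e : g v - g v * Real.exp (-ψ (v / t)) - g v * ψ (v / t)
      = g v * (1 - Real.exp (-ψ (v / t)) - ψ (v / t)) := by ring
  rw [e, norm_mul, Real.norm_eq_abs, Real.norm_eq_abs, mul_assoc, ← mul_pow]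
  exact mul_le_mul_of_nonneg_left ((abs_one_sub_exp_neg_sub_le (hψ0 _)).trans
    (pow_le_pow_left₀ (hψ0 _) (hψle v) 2)) (abs_nonneg _)

end

/-! ### Squeezing the tail, uniformly on the unit sphere -/

lemma modular_eq_one_of_quasinorm_eq_one {α f : ℝ → ℝ} (h : quasinorm α f = 1) :
    modular α f = 1 := by
  unfold quasinorm at h
  split_ifs at h with hex
  · have := hex.choose_spec.1.2
    rw [h] at this
    simpa using this
  -- The default value 0 of the quasinorm cannot equal 1.
  · simp at h

lemma real_tail_le_integral {μ : Measure ℝ} [IsProbabilityMeasure μ] {h : ℝ → ℝ}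
    (hc : Continuous h) (h0 : ∀ x, 0 ≤ h x) (h1 : ∀ x, h x ≤ 1) (hout : ∀ x, 1 ≤ |x| → h x = 0)
    {t : ℝ} (ht : 0 < t) : μ.real {x | t < |x|} ≤ ∫ x, (1 - h (x / t)) ∂μ := by
  have hm : MeasurableSet {x : ℝ | t < |x|} := measurableSet_lt (by fun_prop) (by fun_prop)
  rw [← integral_indicator_one hm]
  have hi : Integrable (fun x => 1 - h (x / t)) μ := by
    refine Integrable.of_bound (C := 1) (Continuous.aestronglyMeasurable (by fun_prop))
      (Eventually.of_forall fun x => ?_)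
    rw [Real.norm_eq_abs, abs_le]
    constructor <;> linarith [h0 (x / t), h1 (x / t)]
  refine integral_mono ((integrable_const (1 : ℝ)).indicator hm) hi fun x => ?_
  by_cases hx : t < |x|
  · have : 1 ≤ |x / t| := by
      rw [abs_div, abs_of_pos ht, one_le_div ht]; exact hx.le
    simp [hout _ this, hx]
  · simp [hx, h1]

lemma integral_le_real_tail {μ : Measure ℝ} [IsProbabilityMeasure μ] {h : ℝ → ℝ}
    (hc : Continuous h) (h0 : ∀ x, 0 ≤ h x) (h1 : ∀ x, h x ≤ 1) (hin : ∀ x, |x| ≤ 1 → h x = 1)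
    {t : ℝ} (ht : 0 < t) : ∫ x, (1 - h (x / t)) ∂μ ≤ μ.real {x | t < |x|} := by
  have hm : MeasurableSet {x : ℝ | t < |x|} := measurableSet_lt (by fun_prop) (by fun_prop)
  rw [← integral_indicator_one hm]
  have hi : Integrable (fun x => 1 - h (x / t)) μ := by
    refine Integrable.of_bound (C := 1) (Continuous.aestronglyMeasurable (by fun_prop))
      (Eventually.of_forall fun x => ?_)
    rw [Real.norm_eq_abs, abs_le]
    constructor <;> linarith [h0 (x / t), h1 (x / t)]
  refine integral_mono hi ((integrable_const (1 : ℝ)).indicator hm) fun x => ?_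
  by_cases hx : t < |x|
  · simp [hx, h0]
  · have : |x / t| ≤ 1 := by
      rw [abs_div, abs_of_pos ht, div_le_one ht]; exact not_lt.1 hx
    simp [hin _ this, hx]

/-- The tail is asymptotic to the tail of the Lévy measure, with a uniform rate up to an
arbitrarily small relative error. -/
lemma exists_tail_ratio_bound {a b : ℝ} (ha : 0 < a) (hb : b < 2) {α : ℝ → ℝ}
    (hα : AEMeasurable α volume) (hαab : ∀ᵐ x : ℝ, α x ∈ Set.Icc a b)
    {δ : ℝ} (hδ : 0 < δ) (hδ1 : δ ≤ 1) :
    ∃ K : ℝ, ∀ (μ : Measure ℝ) [IsProbabilityMeasure μ] (w : ℝ → ℝ), Integrable w →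
      (∀ x, 0 ≤ w x) → ∫ x, w x = 1 →
      (∀ θ, ∫ x, Real.cos (θ * x) ∂μ = Real.exp (-∫ x, w x * |θ| ^ α x)) → ∀ t : ℝ, 1 ≤ t →
      |μ.real {x | t < |x|} / (∫ x, w x * t ^ (-α x) * tailConst (α x)) - 1|
        ≤ 3 * δ + K * t ^ (-a) := by
  obtain ⟨c, C, hc, hcC⟩ := exists_tailConst_bounds ha hb
  have hr : (0 : ℝ) < (1 + δ)⁻¹ := by positivity
  -- `h` drops from 1 to 0 on `[(1+δ)⁻¹, 1]` and bounds the tail from above; `h'` drops on `[1,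
  -- 1+δ]` and bounds it from below.
  have hr1 : (1 + δ)⁻¹ < 1 := inv_lt_one_of_one_lt₀ (by linarith)
  obtain ⟨h, g, hhc, hh0, hh1, hin, hout, hg, hgi, hhg⟩ := exists_cutoff hr hr1
  obtain ⟨h', g', hhc', hh0', hh1', hin', hout', hg', hgi', hhg'⟩ :=
    exists_cutoff one_pos (show (1 : ℝ) < 1 + δ by linarith)
  set A := ∫ v, |g v| * (1 + v ^ 2) ^ 2 with hA
  set A' := ∫ v, |g' v| * (1 + v ^ 2) ^ 2 with hA'
  have hA0 : 0 ≤ A := integral_nonneg fun v => by positivity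
  have hA0' : 0 ≤ A' := integral_nonneg fun v => by positivity
  have hpow : ∀ γ ∈ Set.Icc a b, 0 < (1 + δ) ^ γ ∧ (1 + δ) ^ γ ≤ 1 + 3 * δ := fun γ hγ => by
    refine ⟨by positivity, ?_⟩
    have := Real.rpow_le_rpow_of_exponent_le (show 1 ≤ 1 + δ by linarith) (hγ.2.trans hb.le)
    rw [Real.rpow_two] at this
    nlinarith
  have hup : ∀ γ ∈ Set.Icc a b, ∫ v, g v * |v| ^ γ ≤ tailConst γ * (1 + 3 * δ) := fun γ hγ => by
    have hγ0 := ha.trans_le hγ.1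
    have hγ2 := hγ.2.trans_lt hb
    refine (moment_bounds hr hr1 hh0 hh1 hin hout hg hgi hhg hγ0 hγ2).2.trans ?_
    rw [Real.inv_rpow (by positivity), Real.rpow_neg (by positivity), inv_inv]
    exact mul_le_mul_of_nonneg_left (hpow γ hγ).2 (tailConst_pos hγ0 hγ2).le
  have hlow : ∀ γ ∈ Set.Icc a b, tailConst γ * (1 - 3 * δ) ≤ ∫ v, g' v * |v| ^ γ :=
    fun γ hγ => by
      have hγ0 := ha.trans_le hγ.1
      have hγ2 := hγ.2.trans_lt hb
      refine le_trans ?_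
        (moment_bounds one_pos (by linarith) hh0' hh1' hin' hout' hg' hgi' hhg' hγ0 hγ2).1
      refine mul_le_mul_of_nonneg_left ?_ (tailConst_pos hγ0 hγ2).le
      obtain ⟨p0, p1⟩ := hpow γ hγ
      rw [Real.rpow_neg (by positivity), ← one_div, le_div_iff₀ p0]
      -- `1 - 3δ` may be negative, and then the bound is trivial; otherwise use `(1 - 3δ)(1 + 3δ) ≤
      -- 1`.
      rcases le_total 0 (1 - 3 * δ) with hs | hs <;> nlinarith
  -- This constant depends on the two cutoffs and on the lower bound for `tailConst` only, not on
  -- `μ`, `w` or `t`.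
  refine ⟨(A + A') / c, fun μ _ w hw hw0 hw1 hμ t ht => ?_⟩
  have ht0 : 0 < t := by linarith
  have hwt := integrable_mul_rpow_neg ha hα hαab hw ht
  have hTm := aemeasurable_tailConst_comp ha hb hα hαab
  have hTi : Integrable fun x => w x * t ^ (-α x) * tailConst (α x) := by
    refine hwt.mul_bdd (c := C) hTm.aestronglyMeasurable (hαab.mono fun x hx => ?_)
    rw [Real.norm_of_nonneg (hc.le.trans (hcC _ hx).1)]
    exact (hcC _ hx).2
  set T := ∫ x, w x * t ^ (-α x) * tailConst (α x) with hT
  set Ψ := ∫ x, w x * t ^ (-α x) with hΨ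
  have hnn : ∀ x, 0 ≤ w x * t ^ (-α x) := fun x => mul_nonneg (hw0 x) (by positivity)
  have hΨT : c * Ψ ≤ T := by
    rw [hΨ, hT, ← integral_const_mul]
    refine integral_mono_ae (hwt.const_mul c) hTi (hαab.mono fun x hx => ?_)
    simp only
    rw [mul_comm c]
    exact mul_le_mul_of_nonneg_left (hcC _ hx).1 (hnn x)
  have hΨle : Ψ ≤ t ^ (-a) := by
    have : ∫ x, w x * t ^ (-a) = t ^ (-a) := by rw [integral_mul_const, hw1, one_mul]
    rw [← this]
    refine integral_mono_ae hwt (hw.mul_const _) (hαab.mono fun x hx => ?_)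
    exact mul_le_mul_of_nonneg_left
      (Real.rpow_le_rpow_of_exponent_le ht (by linarith [hx.1])) (hw0 x)
  have hΨpos : 0 < Ψ := by
    refine lt_of_lt_of_le (Real.rpow_pos_of_pos ht0 (-b)) ?_
    have : ∫ x, w x * t ^ (-b) = t ^ (-b) := by rw [integral_mul_const, hw1, one_mul]
    rw [← this]
    refine integral_mono_ae (hw.mul_const _) hwt (hαab.mono fun x hx => ?_)
    exact mul_le_mul_of_nonneg_left
      (Real.rpow_le_rpow_of_exponent_le ht (by linarith [hx.2])) (hw0 x)
  have hTpos : 0 < T := (mul_pos hc hΨpos).trans_le hΨT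
  -- One factor `Ψ` is at most `t^(-a)`, the other at most `T/c`: the quadratic error becomes a
  -- relative one.
  have hsq : Ψ ^ 2 ≤ t ^ (-a) / c * T := by
    rw [div_mul_eq_mul_div, le_div_iff₀ hc]
    nlinarith
  obtain ⟨iN, eN⟩ := tail_functional_approx ha hb hα hαab hw hw0 hμ hhc hh0 hh1
    (hin 0 (by simpa using hr.le)) hg hgi hhg ht
  obtain ⟨iN', eN'⟩ := tail_functional_approx ha hb hα hαab hw hw0 hμ hhc' hh0' hh1'
    (hin' 0 (by simp)) hg' hgi' hhg' ht
  have hN : ∫ x, w x * t ^ (-α x) * ∫ v, g v * |v| ^ α x ≤ (1 + 3 * δ) * T := by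
    rw [hT, ← integral_const_mul]
    refine integral_mono_ae iN (hTi.const_mul _) (hαab.mono fun x hx => ?_)
    simp only
    rw [mul_left_comm, mul_comm (1 + 3 * δ)]
    exact mul_le_mul_of_nonneg_left (hup _ hx) (hnn x)
  have hN' : (1 - 3 * δ) * T ≤ ∫ x, w x * t ^ (-α x) * ∫ v, g' v * |v| ^ α x := by
    rw [hT, ← integral_const_mul]
    refine integral_mono_ae (hTi.const_mul _) iN' (hαab.mono fun x hx => ?_)
    simp only
    rw [mul_left_comm, mul_comm (1 - 3 * δ)]
    exact mul_le_mul_of_nonneg_left (hlow _ hx) (hnn x)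
  have hPle := real_tail_le_integral (μ := μ) hhc hh0 hh1 hout ht0
  have hPge := integral_le_real_tail (μ := μ) hhc' hh0' hh1' hin' ht0
  rw [← hA, ← hΨ, abs_le] at eN
  rw [← hA', ← hΨ, abs_le] at eN'
  have e1 : A * Ψ ^ 2 ≤ A * (t ^ (-a) / c * T) := mul_le_mul_of_nonneg_left hsq hA0
  have e2 : A' * Ψ ^ 2 ≤ A' * (t ^ (-a) / c * T) := mul_le_mul_of_nonneg_left hsq hA0'
  have e3 : 0 ≤ t ^ (-a) / c * T := by positivity
  have e4 : (3 * δ + (A + A') / c * t ^ (-a)) * T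
      = 3 * δ * T + A * (t ^ (-a) / c * T) + A' * (t ^ (-a) / c * T) := by ring
  have e5 := mul_nonneg hA0 e3
  have e6 := mul_nonneg hA0' e3
  rw [div_sub_one hTpos.ne', abs_div, abs_of_pos hTpos, div_le_iff₀ hTpos, e4, abs_le]
  constructor <;> linarith [eN.1, eN.2, eN'.1, eN'.2]

end Multistable

theorem theorem2 (a b : ℝ) (ha : 0 < a) (hb : b < 2)
    (α : ℝ → ℝ) (hα : AEMeasurable α volume) (hαab : ∀ᵐ x : ℝ, α x ∈ Set.Icc a b)
    {Ω : Type*} [MeasurableSpace Ω] (P : Measure Ω) [IsProbabilityMeasure P]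
    (I : Multistable.space α → Ω → ℝ) (hI : Multistable.IsMultistableIntegral α P I) :
    Tendsto
      (fun t : ℝ => ⨆ f ∈ Multistable.unitSphere α,
        ENNReal.ofReal |P.real {ω | t < |I f ω|} / Multistable.tailTerm α f t - 1|)
      atTop (𝓝 0) := by
  rw [ENNReal.tendsto_nhds_zero]
  intro ε hε
  obtain ⟨η, hη0, hηε⟩ := ENNReal.lt_iff_exists_real_btwn.1 hε
  have hη : 0 < η := ENNReal.ofReal_pos.1 hηε.1
  -- With this `δ`, the cutoff error `3δ` is at most `η/2`; the other half is left for `K t^(-a)`.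
  have hδ : 0 < min 1 (η / 6) := lt_min one_pos (by positivity)
  obtain ⟨K, hK⟩ := Multistable.exists_tail_ratio_bound ha hb hα hαab hδ (min_le_left _ _)
  have hlim : Tendsto (fun t : ℝ => K * t ^ (-a)) atTop (𝓝 0) := by
    simpa using (tendsto_rpow_neg_atTop ha).const_mul K
  filter_upwards [eventually_ge_atTop 1, hlim.eventually_lt_const (half_pos hη)] with t ht hKt
  refine iSup₂_le fun f hf => le_trans (ENNReal.ofReal_le_ofReal ?_) hηε.2.le
  have ht0 : 0 < t := by linarith
  have hmod := Multistable.modular_eq_one_of_quasinorm_eq_one hf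
  have : IsProbabilityMeasure (P.map (I f)) := Measure.isProbabilityMeasure_map (hI.aemeasurable f)
  have key := hK (P.map (I f)) (fun x => |(f : ℝ → ℝ) x| ^ α x) f.2.2 (fun x => by positivity) hmod
    (Multistable.integral_cos_eq hI f) t ht
  have e1 : (P.map (I f)).real {x | t < |x|} = P.real {ω | t < |I f ω|} :=
    map_measureReal_apply_of_aemeasurable (hI.aemeasurable f)
      (measurableSet_lt (by fun_prop) (by fun_prop))
  have e2 : ∫ x : ℝ, |(f : ℝ → ℝ) x| ^ α x * t ^ (-α x) * Multistable.tailConst (α x)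
      = Multistable.tailTerm α f t := by
    refine integral_congr_ae (Eventually.of_forall fun x => ?_)
    simp only
    rw [abs_mul, abs_of_pos (inv_pos.2 ht0), Real.mul_rpow (by positivity) (by positivity),
      Real.inv_rpow ht0.le, Real.rpow_neg ht0.le, mul_comm (|(f : ℝ → ℝ) x| ^ α x)]
  rw [e1, e2] at key
  have := min_le_right 1 (η / 6)
  linarith
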